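/- Let ${\bf t} = t[0]\,t[1]\,t[2]\cdots = 01101001\cdots$ be the Thue-Morse word, i.e., the infinite word, indexed from $0$, that starts with $0$ and is fixed by the morphism $0 \mapsto 01$, $1 \mapsto 10$. (a) For all integers $a, b$ with $1 \leq a < b$ there exists an integer $n$ with $0 \leq n \leq \frac{5}{3} b$ such that $t[n] \notin \{ t[n+a], t[n+b] \}$. (b) This bound is optimal, in the following sense. There are infinitely many pairs $(a,b)$ of integers with $1 \leq a < b$ such that $t[n] \in \{ t[n+a], t[n+b] \}$ for every integer $n$ with $0 \leq n < \frac{5}{3} b$. In particular, for every real number $c < \frac{5}{3}$ there are infinitely many pairs $(a,b)$ of integers with $1 \leq a < b$ for which no integer $n$ with $0 \leq n \leq c\,b$ satisfies $t[n] \notin \{ t[n+a], t[n+b] \}$. -/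

import Mathlib

/-- The Thue-Morse morphism on letters: `0 ↦ 01`, `1 ↦ 10`. -/
def tmMorphism (c : Fin 2) : List (Fin 2) := if c = 0 then [0, 1] else [1, 0]

/-- The `k`-th iterate of the Thue-Morse morphism on the one-letter word `0`. -/
def tmIter : ℕ → List (Fin 2)
  | 0 => [0]
  | k + 1 => (tmIter k).flatMap tmMorphism

/-- The Thue-Morse word, indexed from `0`: the infinite word of which all the words `tmIter k`
are prefixes (`tmIter n` has length `2 ^ n > n`, so the default value is never used). -/
def thueMorse (n : ℕ) : Fin 2 := (tmIter n).getD n 0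

theorem tmIter_length (k : ℕ) : (tmIter k).length = 2 ^ k := by
  have h : ∀ l : List (Fin 2), (l.flatMap tmMorphism).length = 2 * l.length := by
    intro l
    induction l with
    | nil => rfl
    | cons c l ih =>
      have hc : (tmMorphism c).length = 2 := by fin_cases c <;> rfl
      simp only [List.flatMap_cons, List.length_append, List.length_cons, hc, ih]
      omega
  induction k with
  | zero => rfl
  | succ k ih => rw [tmIter, h, ih, pow_succ]; ring

theorem tmIter_prefix_succ (k : ℕ) : tmIter k <+: tmIter (k + 1) := by
  induction k with
  | zero => exact ⟨[1], rfl⟩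
  | succ k ih =>
    obtain ⟨s, hs⟩ := ih
    refine ⟨s.flatMap tmMorphism, ?_⟩
    conv_rhs => rw [tmIter, ← hs, List.flatMap_append]
    rw [tmIter]

theorem tmIter_prefix {k m : ℕ} (h : k ≤ m) : tmIter k <+: tmIter m := by
  induction m, h using Nat.le_induction with
  | base => exact List.prefix_rfl
  | succ m _ ih => exact ih.trans (tmIter_prefix_succ m)

theorem tmIter_getD {k n : ℕ} (h : n < 2 ^ k) : (tmIter k).getD n 0 = thueMorse n := by
  have key : ∀ {i j : ℕ}, i ≤ j → n < 2 ^ i → (tmIter i).getD n 0 = (tmIter j).getD n 0 := by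
    intro i j hij hn
    obtain ⟨s, hs⟩ := tmIter_prefix hij
    rw [← hs, List.getD_append _ _ _ _ (by rw [tmIter_length]; exact hn)]
  rcases le_total k n with hkn | hkn
  · exact key hkn h
  · exact (key hkn Nat.lt_two_pow_self).symm

/-- The Thue-Morse word starts with `0`. -/
theorem thueMorse_zero : thueMorse 0 = 0 := rfl

/-- The Thue-Morse word is fixed by the morphism: the block of length `2` at position `2 * n` is
the image of the letter at position `n`. -/
theorem thueMorse_fixed (n : ℕ) :
    [thueMorse (2 * n), thueMorse (2 * n + 1)] = tmMorphism (thueMorse n) := by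
  have h : ∀ (l : List (Fin 2)) (i : ℕ), i < l.length →
      [(l.flatMap tmMorphism).getD (2 * i) 0, (l.flatMap tmMorphism).getD (2 * i + 1) 0]
        = tmMorphism (l.getD i 0) := by
    intro l
    induction l with
    | nil => intro i hi; simp at hi
    | cons c l ih =>
      intro i hi
      have hc : ∃ x y, tmMorphism c = [x, y] := by
        fin_cases c
        · exact ⟨0, 1, rfl⟩
        · exact ⟨1, 0, rfl⟩
      obtain ⟨x, y, hxy⟩ := hc
      cases i with
      | zero => simp [hxy]
      | succ i =>
        have := ih i (by simpa using hi)
        simpa [hxy, Nat.mul_succ] using this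
  have hn : n < 2 ^ n := Nat.lt_two_pow_self
  have := h (tmIter n) n (by rw [tmIter_length]; exact hn)
  have e : (tmIter n).flatMap tmMorphism = tmIter (n + 1) := rfl
  rw [e, tmIter_getD (by rw [pow_succ]; omega), tmIter_getD (by rw [pow_succ]; omega),
    tmIter_getD hn] at this
  exact this

/-! Upper bound: since `t[2m+i]` is `t[m]` flipped by `i`, a mismatch for two shifts reduces to one
of finitely many patterns for the halved shifts, with carries as offsets. Reading the binary digits
of both shifts from the lowest gives a finite automaton on lists of patterns; its closure and the
cases `4 ≤ b < 8` are decided by computation, and the bound `5b/3` survives doubling. Optimality: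
for the shifts `2 * 2 ^ k` and `3 * 2 ^ k` the first mismatch is not before `5 * 2 ^ k`. -/

/-! ### The Thue-Morse word as a sequence of bits -/

/-- The letters of the Thue-Morse word as truth values. -/
def tmBit (n : ℕ) : Bool := thueMorse n == 1

theorem tmBit_double (n : ℕ) : tmBit (2 * n) = tmBit n ∧ tmBit (2 * n + 1) = !tmBit n := by
  have h := thueMorse_fixed n
  have hc : ∀ x y c : Fin 2, [x, y] = tmMorphism c → (x == 1) = (c == 1) ∧ (y == 1) = !(c == 1) := by
    decide
  exact hc _ _ _ h

theorem tmBit_two_mul_add (m i : ℕ) (hi : i < 2) :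
    tmBit (2 * m + i) = (tmBit m ^^ (i == 1)) := by
  obtain ⟨h0, h1⟩ := tmBit_double m
  interval_cases i
  · simpa using h0
  · simpa using h1

theorem tmBit_eq (x : ℕ) : tmBit x = (tmBit (x / 2) ^^ (x % 2 == 1)) := by
  conv_lhs => rw [← Nat.div_add_mod x 2]
  exact tmBit_two_mul_add _ _ (Nat.mod_lt _ two_pos)

theorem thueMorse_notMem_iff (n a b : ℕ) :
    thueMorse n ∉ ({thueMorse (n + a), thueMorse (n + b)} : Set (Fin 2)) ↔
      tmBit (n + a) = !tmBit n ∧ tmBit (n + b) = !tmBit n := by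
  have h : ∀ x y z : Fin 2, ¬ (x = y ∨ x = z) ↔ (y == 1) = !(x == 1) ∧ (z == 1) = !(x == 1) := by
    decide
  exact h _ _ _

/-- The first `32` terms of the sequence `tmBit`, in a form that evaluates quickly. -/
def tmPrefix (n : ℕ) : Bool := (n + n / 2 + n / 4 + n / 8 + n / 16) % 2 == 1

/-- Modulo 2, `n / 2 ^ i` is the `i`-th binary digit, so `tmPrefix` is the parity of the digit sum
below `32`. -/
theorem tmBit_eq_tmPrefix {n : ℕ} (h : n < 32) : tmBit n = tmPrefix n := by
  have key : ∀ n < 32, ((tmIter 5).getD n 0 == 1) = tmPrefix n := by decide +kernel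
  rw [← key n h, tmBit, tmIter_getD (k := 5) h]

/-! ### Patterns -/

/-- A pattern for the shifts `(a, b)` is given by `c`, `d` and two truth values `s`, `r`, encoded in the
binary digits of the number `8 * c + 4 * s + 2 * d + r`. It occurs at `n` if the letter at `n` differs
from the one at `n + a + c` exactly when `s` holds, and from the one at `n + b + d` exactly when `r`
holds. -/
def PatternOccursAt (e : ℕ) (a b n : ℕ) : Prop :=
  tmBit (n + (a + e / 8)) = (tmBit n ^^ (e / 4 % 2 == 1)) ∧
    tmBit (n + (b + e / 2 % 2)) = (tmBit n ^^ (e % 2 == 1))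

/-- The pattern at `m` that amounts to the pattern `e` at `2 * m + i`, where `x` and `y` are the last
binary digits of the two shifts. -/
def halfPattern (x y i e : ℕ) : ℕ :=
  8 * ((x + e / 8 + i) / 2) + 4 * ((e / 4 + (x + e / 8 + i) + i) % 2) +
    2 * ((y + e / 2 % 2 + i) / 2) + (e + (y + e / 2 % 2 + i) + i) % 2

theorem pattern_digits (c : ℕ) {s d r : ℕ} (hs : s < 2) (hd : d < 2) (hr : r < 2) :
    (8 * c + 4 * s + 2 * d + r) / 8 = c ∧ (8 * c + 4 * s + 2 * d + r) / 4 % 2 = s ∧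
      (8 * c + 4 * s + 2 * d + r) / 2 % 2 = d ∧ (8 * c + 4 * s + 2 * d + r) % 2 = r := by
  omega

theorem add_add_mod_two_beq (p q i : ℕ) (hi : i < 2) :
    ((p + q + i) % 2 == 1) = ((p % 2 == 1) ^^ (q % 2 == 1) ^^ (i == 1)) := by
  rw [Nat.add_mod, Nat.add_mod p]
  rcases Nat.mod_two_eq_zero_or_one p with hp | hp <;>
  rcases Nat.mod_two_eq_zero_or_one q with hq | hq <;>
  interval_cases i <;> simp [hp, hq]

theorem tmBit_shift_of_half {m a x c i : ℕ} {s : Bool} (hi : i < 2)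
    (h : tmBit (m + (a + (x + c + i) / 2)) =
      (tmBit m ^^ (s ^^ ((x + c + i) % 2 == 1) ^^ (i == 1)))) :
    tmBit (2 * m + i + (2 * a + x + c)) = (tmBit (2 * m + i) ^^ s) := by
  rw [tmBit_two_mul_add m i hi, tmBit_eq (2 * m + i + (2 * a + x + c)),
    show (2 * m + i + (2 * a + x + c)) / 2 = m + (a + (x + c + i) / 2) by omega,
    show (2 * m + i + (2 * a + x + c)) % 2 = (x + c + i) % 2 by omega, h]
  cases tmBit m <;> cases s <;> cases ((x + c + i) % 2 == 1) <;> cases (i == 1) <;> rfl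

/-- Adding `x + c + i` at the last digit leaves the carry `(x + c + i) / 2`, the new offset; the
last digits before and after the shift flip the required truth value. Offsets at most 1 stay at most
1, so finitely many patterns arise. -/
theorem PatternOccursAt.of_half {e a b m x y i : ℕ} (hy : y < 2) (hi : i < 2)
    (h : PatternOccursAt (halfPattern x y i e) a b m) :
    PatternOccursAt e (2 * a + x) (2 * b + y) (2 * m + i) := by
  obtain ⟨h1, h2⟩ := h
  obtain ⟨e1, e2, e3, e4⟩ := pattern_digits ((x + e / 8 + i) / 2)
    (s := (e / 4 + (x + e / 8 + i) + i) % 2) (d := (y + e / 2 % 2 + i) / 2)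
    (r := (e + (y + e / 2 % 2 + i) + i) % 2) (by omega) (by omega) (by omega)
  rw [halfPattern, e1, e2, add_add_mod_two_beq _ _ _ hi] at h1
  rw [halfPattern, e3, e4, add_add_mod_two_beq _ _ _ hi] at h2
  exact ⟨tmBit_shift_of_half hi h1, tmBit_shift_of_half hi h2⟩

/-- Some pattern of the list `S` occurs before position `N`. -/
def OccursBefore (S : List ℕ) (a b N : ℕ) : Prop :=
  ∃ n < N, ∃ e ∈ S, PatternOccursAt e a b n

def halfPatterns (x y : ℕ) (S : List ℕ) : List ℕ :=
  (S.map (halfPattern x y 0) ++ S.map (halfPattern x y 1)).dedup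

theorem OccursBefore.of_half {S : List ℕ} {a b N x y : ℕ} (hy : y < 2)
    (h : OccursBefore (halfPatterns x y S) a b N) :
    OccursBefore S (2 * a + x) (2 * b + y) (2 * N) := by
  obtain ⟨m, hm, e', he', h⟩ := h
  simp only [halfPatterns, List.mem_dedup, List.mem_append, List.mem_map] at he'
  obtain ⟨e, he, rfl⟩ | ⟨e, he, rfl⟩ := he'
  · exact ⟨2 * m + 0, by omega, e, he, h.of_half hy (by omega)⟩
  · exact ⟨2 * m + 1, by omega, e, he, h.of_half hy (by omega)⟩

theorem OccursBefore.mono {S T : List ℕ} {a b N : ℕ} (hST : S ⊆ T)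
    (h : OccursBefore S a b N) : OccursBefore T a b N := by
  obtain ⟨n, hn, e, he, h⟩ := h
  exact ⟨n, hn, e, hST he, h⟩

/-! ### A finite automaton reading the binary digits of the two shifts -/

/-- A list of patterns, of which one has to be found, with two flags for the digits read so far:
whether those of the first shift form a smaller number than those of the second, and whether those of
the first shift are not all zero. -/
abbrev TMState := List ℕ × Bool × Bool

/-- Each digit read is more significant than the earlier ones, so the old comparison counts only if
`x = y`. -/
def TMState.next (q : TMState) (x y : ℕ) : TMState :=
  (halfPatterns x y q.1, decide (x < y) || (decide (x = y) && q.2.1), q.2.2 || decide (x = 1))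

/-- `p.Le q`: the patterns of `p` are among those of `q`, and the flags set in `q` are set in `p`. -/
def TMState.Le (p q : TMState) : Prop :=
  p.1 ⊆ q.1 ∧ (q.2.1 = true → p.2.1 = true) ∧ (q.2.2 = true → p.2.2 = true)

instance (p q : TMState) : Decidable (p.Le q) :=
  inferInstanceAs (Decidable (_ ∧ _ ∧ _))

/-- The remaining digits of the two shifts may be those of `a` and `b`, where `a ≤ b`, if the first
shift is to be positive and less than the second. -/
def TMState.Admits (q : TMState) (a b : ℕ) : Prop :=
  (a = b → q.2.1 = true) ∧ (a = 0 → q.2.2 = true)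

instance (q : TMState) (a b : ℕ) : Decidable (q.Admits a b) :=
  inferInstanceAs (Decidable (_ ∧ _))

/-- `5 = 4 + 1`: no offsets, a mismatch for both shifts. -/
def TMState.start : TMState := ([5], false, false)

/-- Adds the states of the second list that are not above a state already present. -/
def addMinimal (L : List TMState) (M : List TMState) : List TMState :=
  M.foldl (fun L q => if ∃ p ∈ L, p.Le q then L else L ++ [q]) L

def TMState.successors (q : TMState) : List TMState :=
  [q.next 0 0, q.next 0 1, q.next 1 0, q.next 1 1]

/-- The states reached from the shifts that are not both even, up to `TMState.Le`. -/
def tmStates : List TMState :=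
  (fun L => addMinimal L (L.flatMap TMState.successors))^[3]
    [TMState.start.next 0 1, TMState.start.next 1 0, TMState.start.next 1 1]

theorem tmStates_start : ∀ x < 2, ∀ y < 2, x + y ≠ 0 →
    ∃ p ∈ tmStates, p.Le (TMState.start.next x y) := by
  decide +kernel

/-- Three rounds of successors close the list up to `TMState.Le`. The smaller state is the harder
one: fewer patterns to find, more pairs admitted. -/
theorem tmStates_next : ∀ q ∈ tmStates, ∀ x < 2, ∀ y < 2, ∃ p ∈ tmStates, p.Le (q.next x y) := by
  decide +kernel

/-- A version of `OccursBefore` that can be evaluated for small shifts. -/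
def occursBeforeSmall (S : List ℕ) (a b N : ℕ) : Bool :=
  (List.range N).any fun n => S.any fun e =>
    decide (n + (a + e / 8) < 32 ∧ n + (b + e / 2 % 2) < 32 ∧
      tmPrefix (n + (a + e / 8)) = (tmPrefix n ^^ (e / 4 % 2 == 1)) ∧
      tmPrefix (n + (b + e / 2 % 2)) = (tmPrefix n ^^ (e % 2 == 1)))

theorem OccursBefore.of_small {S : List ℕ} {a b N : ℕ}
    (h : occursBeforeSmall S a b N = true) : OccursBefore S a b N := by
  simp only [occursBeforeSmall, List.any_eq_true, List.mem_range, decide_eq_true_eq] at h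
  obtain ⟨n, hn, e, he, h1, h2, h3, h4⟩ := h
  refine ⟨n, hn, e, he, ?_, ?_⟩
  · rwa [tmBit_eq_tmPrefix h1, tmBit_eq_tmPrefix (by omega)]
  · rwa [tmBit_eq_tmPrefix h2, tmBit_eq_tmPrefix (by omega)]

/-- Repeated halving of any `b ≥ 8` ends in this range. -/
theorem tmStates_small : ∀ q ∈ tmStates, ∀ b < 8, ∀ a < b + 1, 4 ≤ b → q.Admits a b →
    occursBeforeSmall q.1 a b (5 * b / 3) = true := by
  decide +kernel

theorem exists_occursBefore_of_mem_tmStates {b : ℕ} (hb : 4 ≤ b) :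
    ∀ q ∈ tmStates, ∀ a ≤ b, q.Admits a b → ∃ N, 3 * N ≤ 5 * b ∧ OccursBefore q.1 a b N := by
  induction b using Nat.strong_induction_on with
  | _ b ih =>
    intro q hq a hab hadm
    rcases lt_or_ge b 8 with h8 | h8
    · exact ⟨5 * b / 3, by omega,
        .of_small (tmStates_small q hq b h8 a (by omega) hb hadm)⟩
    · obtain ⟨p, hp, hS, hl, hr⟩ := tmStates_next q hq (a % 2) (Nat.mod_lt _ two_pos) (b % 2)
        (Nat.mod_lt _ two_pos)
      obtain ⟨N, hN, h⟩ := ih (b / 2) (by omega) (by omega) p hp (a / 2) (by omega)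
        ⟨fun h => hl (by
          by_cases hxy : a % 2 < b % 2
          · simp [TMState.next, hxy]
          · simp [TMState.next, hadm.1 (by omega), show a % 2 = b % 2 by omega]),
        fun h => hr (by
          by_cases hx : a % 2 = 1
          · simp [TMState.next, hx]
          · simp [TMState.next, hadm.2 (by omega)])⟩
      -- The strict bound `n < N` absorbs the parity of the position: `m < N` gives `2 * m + 1 < 2 *
      -- N`.
      refine ⟨2 * N, by omega, ?_⟩
      have := (h.mono hS).of_half (Nat.mod_lt _ two_pos)
      rwa [Nat.div_add_mod, Nat.div_add_mod] at this

/-! ### Pairs of shifts -/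

theorem exists_mismatch_small : ∀ b < 8, ∀ a < b, 1 ≤ a → ∃ n < 5 * b / 3 + 1,
    tmPrefix (n + a) = (!tmPrefix n) ∧ tmPrefix (n + b) = !tmPrefix n := by
  decide +kernel

theorem exists_mismatch (a b : ℕ) (ha : 1 ≤ a) (hab : a < b) :
    ∃ n, 3 * n ≤ 5 * b ∧ tmBit (n + a) = (!tmBit n) ∧ tmBit (n + b) = !tmBit n := by
  induction b using Nat.strong_induction_on generalizing a with
  | _ b ih =>
    rcases lt_or_ge b 8 with h8 | h8
    · obtain ⟨n, hn, h1, h2⟩ := exists_mismatch_small b h8 a hab ha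
      refine ⟨n, by omega, ?_⟩
      rw [tmBit_eq_tmPrefix (show n + a < 32 by omega),
        tmBit_eq_tmPrefix (show n + b < 32 by omega), tmBit_eq_tmPrefix (show n < 32 by omega)]
      exact ⟨h1, h2⟩
    -- Two even shifts are kept out of the automaton: its strict bound fails for `(2 * 2 ^ k, 3 * 2
    -- ^ k)`, while the position `2 * m` preserves the weak one.
    by_cases hpar : a % 2 + b % 2 = 0
    · obtain ⟨m, hm, h1, h2⟩ := ih (b / 2) (by omega) (a / 2) (by omega) (by omega)
      refine ⟨2 * m, by omega, ?_⟩
      rw [show 2 * m + a = 2 * (m + a / 2) by omega, show 2 * m + b = 2 * (m + b / 2) by omega,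
        (tmBit_double _).1, (tmBit_double _).1, (tmBit_double _).1]
      exact ⟨h1, h2⟩
    · obtain ⟨p, hp, hS, hl, hr⟩ := tmStates_start (a % 2) (Nat.mod_lt _ two_pos) (b % 2)
        (Nat.mod_lt _ two_pos) hpar
      obtain ⟨N, hN, h⟩ := exists_occursBefore_of_mem_tmStates (b := b / 2) (by omega) p hp (a / 2)
        (by omega)
        ⟨fun h => hl (by simp [TMState.next, show a % 2 < b % 2 by omega]),
        fun h => hr (by simp [TMState.next, show a % 2 = 1 by omega])⟩
      have h' := (h.mono hS).of_half (Nat.mod_lt _ two_pos)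
      rw [Nat.div_add_mod, Nat.div_add_mod] at h'
      obtain ⟨n, hn, e, he, h1, h2⟩ := h'
      obtain rfl : e = 5 := by simpa [TMState.start] using he
      exact ⟨n, by omega, by simpa using h1, by simpa using h2⟩

/-- For `k > 0` both shifts are even, so the last digit of `n` cancels and `n / 2` is a mismatch for
`k - 1`. -/
theorem le_of_mismatch_two_pow (k n : ℕ) (h2 : tmBit (n + 2 * 2 ^ k) = !tmBit n)
    (h3 : tmBit (n + 3 * 2 ^ k) = !tmBit n) : 5 * 2 ^ k ≤ n := by
  induction k generalizing n with
  | zero =>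
    have key : ∀ n < 5, tmPrefix (n + 2) = (!tmPrefix n) → tmPrefix (n + 3) ≠ !tmPrefix n := by
      decide +kernel
    by_contra! hn
    refine key n (by omega) ?_ ?_
    · rwa [← tmBit_eq_tmPrefix (by omega), ← tmBit_eq_tmPrefix (by omega)]
    · rwa [← tmBit_eq_tmPrefix (by omega), ← tmBit_eq_tmPrefix (by omega)]
  | succ k ih =>
    rw [pow_succ] at *
    rw [tmBit_eq (n + _), tmBit_eq n, show (n + 2 * (2 ^ k * 2)) / 2 = n / 2 + 2 * 2 ^ k by omega,
      show (n + 2 * (2 ^ k * 2)) % 2 = n % 2 by omega] at h2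
    rw [tmBit_eq (n + _), tmBit_eq n, show (n + 3 * (2 ^ k * 2)) / 2 = n / 2 + 3 * 2 ^ k by omega,
      show (n + 3 * (2 ^ k * 2)) % 2 = n % 2 by omega] at h3
    have := ih (n / 2) (by revert h2; cases n % 2 == 1 <;> simp)
      (by revert h3; cases n % 2 == 1 <;> simp)
    omega

theorem infinite_setOf_no_mismatch_lt :
    {p : ℕ × ℕ | 1 ≤ p.1 ∧ p.1 < p.2 ∧
      ¬ ∃ n : ℕ, (n : ℝ) < 5 / 3 * (p.2 : ℝ) ∧
        thueMorse n ∉ ({thueMorse (n + p.1), thueMorse (n + p.2)} : Set (Fin 2))}.Infinite := by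
  refine Set.infinite_of_injective_forall_mem (f := fun k : ℕ => (2 * 2 ^ k, 3 * 2 ^ k)) ?_ ?_
  · intro k l h
    have h' : 2 * 2 ^ k = 2 * 2 ^ l := congrArg Prod.fst h
    exact Nat.pow_right_injective le_rfl (Nat.eq_of_mul_eq_mul_left two_pos h')
  · intro k
    have hk : 0 < 2 ^ k := by positivity
    refine ⟨by dsimp only; omega, by dsimp only; omega, ?_⟩
    rintro ⟨n, hn, h⟩
    rw [thueMorse_notMem_iff] at h
    have h5 : ((5 * 2 ^ k : ℕ) : ℝ) ≤ n := by exact_mod_cast le_of_mismatch_two_pow k n h.1 h.2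
    push_cast at hn h5
    linarith

theorem mainTheorem4 :
    -- (a)
    (∀ a b : ℕ, 1 ≤ a → a < b →
      ∃ n : ℕ, (n : ℝ) ≤ 5 / 3 * (b : ℝ) ∧
        thueMorse n ∉ ({thueMorse (n + a), thueMorse (n + b)} : Set (Fin 2))) ∧
    -- (b), the inequality `n ≤ (5/3) b` cannot be replaced by the strict one
    {p : ℕ × ℕ | 1 ≤ p.1 ∧ p.1 < p.2 ∧
      ¬ ∃ n : ℕ, (n : ℝ) < 5 / 3 * (p.2 : ℝ) ∧
        thueMorse n ∉ ({thueMorse (n + p.1), thueMorse (n + p.2)} : Set (Fin 2))}.Infinite ∧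
    -- (b), the constant `5/3` cannot be replaced by a smaller one
    (∀ c : ℝ, c < 5 / 3 →
      {p : ℕ × ℕ | 1 ≤ p.1 ∧ p.1 < p.2 ∧
        ¬ ∃ n : ℕ, (n : ℝ) ≤ c * (p.2 : ℝ) ∧
          thueMorse n ∉ ({thueMorse (n + p.1), thueMorse (n + p.2)} : Set (Fin 2))}.Infinite) := by
  refine ⟨fun a b ha hab => ?_, infinite_setOf_no_mismatch_lt, fun c hc =>
    infinite_setOf_no_mismatch_lt.mono ?_⟩
  · obtain ⟨n, hn, h⟩ := exists_mismatch a b ha hab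
    have hn' : (3 * n : ℝ) ≤ 5 * b := by exact_mod_cast hn
    exact ⟨n, by linarith, (thueMorse_notMem_iff n a b).2 h⟩
  · rintro ⟨a, b⟩ ⟨ha, hab, hne⟩
    refine ⟨ha, hab, fun ⟨n, hn, h⟩ => hne ⟨n, hn.trans_lt ?_, h⟩⟩
    have hb : (0 : ℝ) < (b : ℝ) := by
      have : 0 < b := by dsimp only at ha hab; omega
      exact_mod_cast this
    exact mul_lt_mul_of_pos_right hc hb
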